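/- For a relation algebra $\mathbf{A}$ with domain $A$ (signature $\cup,\bar{\ },0,1,\mathrm{id},\breve{\ },\circ$), a *representation* of $\mathbf{A}$ is a (possibly empty) set $B$ together with a binary relation $a^{\mathfrak{B}}\subseteq B^2$ for every $a\in A$ such that $0^{\mathfrak{B}}=\varnothing$, $1^{\mathfrak{B}}=\bigcup_{a\in A}a^{\mathfrak{B}}$, $\mathrm{id}^{\mathfrak{B}}=\{(u,u)\mid u\in B\}$, and, for all $a,b\in A$, $(\bar a)^{\mathfrak{B}}=1^{\mathfrak{B}}\setminus a^{\mathfrak{B}}$, $(\breve a)^{\mathfrak{B}}=\{(u,v)\mid (v,u)\in a^{\mathfrak{B}}\}$, $(a\cup b)^{\mathfrak{B}}=a^{\mathfrak{B}}\cup b^{\mathfrak{B}}$ and $(a\circ b)^{\mathfrak{B}}=a^{\mathfrak{B}}\circ b^{\mathfrak{B}}$. The algebra $\mathbf{A}$ is *representable* if it has a representation. An *$\mathbf{A}$-network* $(V,f)$ consists of a finite set $V$ and a function $f\colon V^2\to A$. It is *satisfiable* if there exist a representation $\mathfrak{B}$ of $\mathbf{A}$ and a function $s\colon V\to B$ such that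 $(s(x),s(y))\in f(x,y)^{\mathfrak{B}}$ for all $x,y\in V$. For a fixed finite relation algebra $\mathbf{A}$, the *network satisfaction problem* $\mathrm{NSP}(\mathbf{A})$ is the computational problem of deciding whether a given $\mathbf{A}$-network is satisfiable. **Lemma.** Let $\mathbf{A}_1$ and $\mathbf{A}_2$ be finite representable relation algebras. If $\mathrm{NSP}(\mathbf{A}_1)$ and $\mathrm{NSP}(\mathbf{A}_2)$ are both in $\mathrm{P}$, then $\mathrm{NSP}(\mathbf{A}_1\times\mathbf{A}_2)$ is in $\mathrm{P}$. If $\mathrm{NSP}(\mathbf{A}_1)$ and $\mathrm{NSP}(\mathbf{A}_2)$ are both in $\mathrm{NP}$, then $\mathrm{NSP}(\mathbf{A}_1\times\mathbf{A}_2)$ is in $\mathrm{NP}$. -/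

import Mathlib

namespace RelAlg

/-- A relation algebra: a Boolean algebra (with join `⊔`, complement `ᶜ`, bottom `⊥`, top `⊤`)
together with an identity element, a converse operation and a composition operation. -/
class RelationAlgebra (A : Type*) extends BooleanAlgebra A where
  /-- the identity element -/
  ident : A
  /-- converse -/
  conv : A → A
  /-- composition -/
  comp : A → A → A
  comp_assoc : ∀ a b c, comp (comp a b) c = comp a (comp b c)
  sup_comp : ∀ a b c, comp (a ⊔ b) c = comp a c ⊔ comp b c
  comp_ident : ∀ a, comp a ident = a
  conv_conv : ∀ a, conv (conv a) = a
  conv_sup : ∀ a b, conv (a ⊔ b) = conv a ⊔ conv b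
  conv_comp : ∀ a b, conv (comp a b) = comp (conv b) (conv a)
  compl_sup_conv_comp : ∀ a b, bᶜ ⊔ comp (conv a) (comp a b)ᶜ = bᶜ

open RelationAlgebra

/-- The direct product of two relation algebras, with componentwise operations. -/
instance instRelationAlgebraProd {A₁ A₂ : Type*} [RelationAlgebra A₁] [RelationAlgebra A₂] :
    RelationAlgebra (A₁ × A₂) where
  ident := (ident, ident)
  conv a := (conv a.1, conv a.2)
  comp a b := (comp a.1 b.1, comp a.2 b.2)
  comp_assoc _ _ _ := Prod.ext (comp_assoc _ _ _) (comp_assoc _ _ _)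
  sup_comp _ _ _ := Prod.ext (sup_comp _ _ _) (sup_comp _ _ _)
  comp_ident _ := Prod.ext (comp_ident _) (comp_ident _)
  conv_conv _ := Prod.ext (conv_conv _) (conv_conv _)
  conv_sup _ _ := Prod.ext (conv_sup _ _) (conv_sup _ _)
  conv_comp _ _ := Prod.ext (conv_comp _ _) (conv_comp _ _)
  compl_sup_conv_comp _ _ := Prod.ext (compl_sup_conv_comp _ _) (compl_sup_conv_comp _ _)

/-- A representation of the relation algebra `A` on the (possibly empty) domain `B`: every
element of `A` is interpreted as a binary relation on `B`. It need not be square, i.e. the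
interpretation of `⊤` need not be the full relation. -/
structure Rep (A : Type*) [RelationAlgebra A] (B : Type*) where
  /-- the interpretation of the elements of `A` -/
  rel : A → SetRel B B
  rel_bot : rel ⊥ = ∅
  rel_top : rel ⊤ = ⋃ a, rel a
  rel_ident : rel ident = {p | p.1 = p.2}
  rel_compl : ∀ a, rel aᶜ = rel ⊤ \ rel a
  rel_conv : ∀ a, rel (conv a) = (rel a).inv
  rel_sup : ∀ a b, rel (a ⊔ b) = rel a ∪ rel b
  rel_comp : ∀ a b, rel (comp a b) = (rel a).comp (rel b)

/-- A relation algebra is representable if it has a representation. -/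
def Representable (A : Type) [RelationAlgebra A] : Prop :=
  ∃ B : Type, Nonempty (Rep A B)

/-- An `A`-network: a finite set of variables, taken to be `{0, …, n - 1}`, and a function
assigning an element of `A` to every pair of variables. -/
structure Network (A : Type) where
  /-- the number of variables -/
  n : ℕ
  /-- the labelling of the pairs of variables -/
  f : Fin n → Fin n → A

/-- An `A`-network is satisfiable if some representation of `A` admits a map from the variables
to its domain which respects all labels. -/
def Network.Satisfiable {A : Type} [RelationAlgebra A] (N : Network A) : Prop :=
  ∃ (B : Type) (R : Rep A B) (s : Fin N.n → B), ∀ x y, (s x, s y) ∈ R.rel (N.f x y)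

/-- The word over the alphabet `A` encoding a network: the `n × n` matrix of labels, row by row. -/
def Network.encode {A : Type} (N : Network A) : List A :=
  (List.finRange N.n).flatMap fun x => (List.finRange N.n).map fun y => N.f x y

/-- The network satisfaction problem of `A`, as a set of words over the alphabet `A`:
the encodings of satisfiable `A`-networks. -/
def NSP (A : Type) [RelationAlgebra A] : Language A :=
  {w | ∃ N : Network A, N.encode = w ∧ N.Satisfiable}

/-- `L` is in P: membership in `L` is computed by a deterministic multi-stack Turing machine in
polynomially many steps. -/
def InP {Γ : Type} (L : Language Γ) : Prop :=
  ∃ f : List Γ → Bool, (∀ w, f w = true ↔ w ∈ L) ∧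
    Nonempty (Turing.TM2ComputableInPolyTime (fun w : List Γ => w) Computability.encodeBool f)

/-- A nondeterministic Turing machine: a machine with two programs `m` and `m'`. In every step
either of them may be executed. -/
structure NTM extends Turing.FinTM2 where
  /-- the second program -/
  m' : Λ → Turing.TM2.Stmt Γ Λ σ

/-- The one-step relation of a nondeterministic machine. -/
def NTM.Step (M : NTM) (c d : M.toFinTM2.Cfg) : Prop :=
  Turing.TM2.step M.m c = some d ∨ Turing.TM2.step M.m' c = some d

/-- `M.Run k c d`: some computation path of exactly `k` steps leads from `c` to `d`. -/
def NTM.Run (M : NTM) : ℕ → M.toFinTM2.Cfg → M.toFinTM2.Cfg → Prop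
  | 0, c, d => c = d
  | k + 1, c, d => ∃ e, M.Step c e ∧ NTM.Run M k e d

/-- `L` is in NP: there is a nondeterministic Turing machine and a polynomial `p` such that, on
every input `w`, all computation paths have at most `p |w|` steps, and `w ∈ L` if and only if some
computation path halts with output `true`. -/
def InNP {Γ : Type} (L : Language Γ) : Prop :=
  ∃ (M : NTM) (inp : M.Γ M.k₀ ≃ Γ) (out : M.Γ M.k₁ ≃ Bool) (p : Polynomial ℕ), ∀ w : List Γ,
    (∀ k c, M.Run k (Turing.initList M.toFinTM2 (w.map inp.symm)) c → k ≤ p.eval w.length) ∧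
    (w ∈ L ↔ ∃ k c, M.Run k (Turing.initList M.toFinTM2 (w.map inp.symm)) c ∧
      c.l = none ∧ c.stk M.k₁ = [out.symm true])

end RelAlg

/-! In a product, `(⊤, ⊥)` and `(⊥, ⊤)` are complementary and compose to `⊥`. Hence a representation
of `A₁ × A₂` falls apart into a piece representing `A₁` and a piece representing `A₂`, with no pair
in the interpretation of `⊤` joining them. A network labels every pair of variables, so a solution
maps all variables into a single piece. Conversely, a representation of one factor becomes one of
the product by composing with the projection, since interpretations need not be injective. So a
network is satisfiable if and only if one of its two projections is
(`Network.satisfiable_prod_iff`). On encodings, projecting a network means projecting each letter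
(`mem_NSP_prod_iff`).

It remains to show that P and NP are closed under unions of letterwise preimages (`InP.union_comap`,
`InNP.union_comap`). One machine serves for both: it writes the two translated inputs, runs the two
given machines one after the other and outputs the disjunction of their answers. A deterministic
machine is treated as a nondeterministic one with two equal programs. Since all paths of both
machines are polynomially bounded, the second run is always reached, and the time bounds add up
(`bounded_unionNTM`, `haltsAt_unionNTM`). -/

namespace RelAlg

open RelationAlgebra

/-! ### Monotonicity and bottom laws in relation algebras. -/

section Algebra

variable {A : Type*} [RelationAlgebra A]

theorem conv_mono {a b : A} (h : a ≤ b) : conv a ≤ conv b := by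
  rw [← sup_eq_right] at h ⊢
  rw [← conv_sup, h]

theorem conv_bot : conv (⊥ : A) = ⊥ := by
  refine le_bot_iff.1 ?_
  simpa only [conv_conv] using conv_mono (bot_le (a := conv (⊥ : A)))

theorem conv_top : conv (⊤ : A) = ⊤ := by
  refine top_le_iff.1 ?_
  simpa only [conv_conv] using conv_mono (le_top (a := conv (⊤ : A)))

theorem comp_mono_left {a b : A} (h : a ≤ b) (c : A) : comp a c ≤ comp b c := by
  rw [← sup_eq_right] at h ⊢
  rw [← sup_comp, h]

theorem comp_mono_right {a b : A} (h : a ≤ b) (c : A) : comp c a ≤ comp c b := by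
  have := conv_mono (comp_mono_left (conv_mono h) (conv c))
  simpa only [conv_comp, conv_conv] using this

/-- The axioms speak of binary joins only, so the empty join needs an argument. The last axiom at `a
= b = ⊤` says that `⊤` composed with a certain element is `⊥`; monotonicity carries this down to
`⊥`. -/
theorem top_comp_bot : comp (⊤ : A) ⊥ = ⊥ := by
  have h := compl_sup_conv_comp (⊤ : A) ⊤
  rw [compl_top, bot_sup_eq, conv_top] at h
  exact le_bot_iff.1 ((comp_mono_right bot_le _).trans h.le)

theorem comp_bot (a : A) : comp a ⊥ = ⊥ :=
  le_bot_iff.1 ((comp_mono_left le_top _).trans top_comp_bot.le)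

theorem bot_comp (a : A) : comp ⊥ a = ⊥ := by
  have h := congrArg conv (comp_bot (conv a))
  rwa [conv_comp, conv_conv, conv_bot] at h

end Algebra

/-! ### Transporting representations along maps of algebras. -/

namespace Rep

variable {A : Type*} [RelationAlgebra A] {B : Type*}

theorem rel_mono (R : Rep A B) {a b : A} (h : a ≤ b) : R.rel a ⊆ R.rel b := by
  rw [← sup_eq_right.2 h, R.rel_sup]
  exact Set.subset_union_left

theorem rel_inf (R : Rep A B) (a b : A) : R.rel (a ⊓ b) = R.rel a ∩ R.rel b := by
  have ha := R.rel_mono (le_top (a := a))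
  -- De Morgan works although complements are relative to `R.rel ⊤`, because `R.rel a` is contained
  -- in it.
  have e : a ⊓ b = (aᶜ ⊔ bᶜ)ᶜ := by simp
  rw [e, R.rel_compl, R.rel_sup, R.rel_compl, R.rel_compl]
  ext p
  have := @ha p
  simp only [Set.mem_sdiff, Set.mem_union, Set.mem_inter_iff]
  tauto

theorem rel_comp_mem (R : Rep A B) {a b : A} {u v w : B} (h : (u, v) ∈ R.rel a)
    (h' : (v, w) ∈ R.rel b) : (u, w) ∈ R.rel (comp a b) := by
  rw [R.rel_comp]
  exact ⟨v, h, h'⟩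

/-- A representation of `A` pulled back along a map `g` which has all the properties of a
projection of relation algebras. -/
def pullback {A' : Type*} [RelationAlgebra A'] (R : Rep A B) (g : A' → A)
    (hbot : g ⊥ = ⊥) (htop : g ⊤ = ⊤) (hident : g ident = ident) (hcompl : ∀ a, g aᶜ = (g a)ᶜ)
    (hconv : ∀ a, g (conv a) = conv (g a)) (hsup : ∀ a b, g (a ⊔ b) = g a ⊔ g b)
    (hcomp : ∀ a b, g (comp a b) = comp (g a) (g b)) : Rep A' B where
  rel a := R.rel (g a)
  rel_bot := by rw [hbot, R.rel_bot]
  rel_top := by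
    rw [htop]
    refine Set.Subset.antisymm ?_ (Set.iUnion_subset fun a => R.rel_mono le_top)
    rw [← htop]
    exact Set.subset_iUnion (fun a => R.rel (g a)) ⊤
  rel_ident := by rw [hident, R.rel_ident]
  rel_compl a := by rw [hcompl, htop, R.rel_compl]
  rel_conv a := by rw [hconv, R.rel_conv]
  rel_sup a b := by rw [hsup, R.rel_sup]
  rel_comp a b := by rw [hcomp, R.rel_comp]

variable {A' : Type*} [RelationAlgebra A']

/-- The representation of a relation algebra `A'` obtained from a representation of `A` and an
embedding `g` of `A'` as a relative subalgebra of `A`, on the points where `g ⊤` is reflexive. -/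
def restrict (R : Rep A B) (g : A' → A) (hbot : g ⊥ = ⊥) (hident : g ident = ident ⊓ g ⊤)
    (hcompl : ∀ a, g aᶜ = (g a)ᶜ ⊓ g ⊤)
    (hconv : ∀ a, g (conv a) = conv (g a)) (hsup : ∀ a b, g (a ⊔ b) = g a ⊔ g b)
    (hcomp : ∀ a b, g (comp a b) = comp (g a) (g b)) :
    Rep A' {u : B // (u, u) ∈ R.rel (g ⊤)} where
  rel a := {p | (p.1.1, p.2.1) ∈ R.rel (g a)}
  rel_bot := by simp [hbot, R.rel_bot]
  rel_top := by
    refine Set.Subset.antisymm (fun p hp => Set.mem_iUnion.2 ⟨⊤, hp⟩)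
      (Set.iUnion_subset fun a _ hp => ?_)
    refine R.rel_mono (a := g a) ?_ hp
    rw [← sup_eq_right, ← hsup, sup_top_eq]
  rel_ident := by
    ext ⟨u, v⟩
    simp only [hident, R.rel_inf, R.rel_ident, Set.mem_ofPred_eq, Set.mem_inter_iff]
    constructor
    · rintro ⟨h, -⟩
      exact Subtype.ext h
    · rintro rfl
      exact ⟨rfl, u.2⟩
  rel_compl a := by
    ext ⟨u, v⟩
    have : (u.1, v.1) ∈ R.rel (g ⊤) → (u.1, v.1) ∈ R.rel ⊤ := fun h => R.rel_mono le_top h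
    simp only [hcompl, R.rel_inf, R.rel_compl, Set.mem_ofPred_eq, Set.mem_inter_iff, Set.mem_sdiff]
    tauto
  rel_conv a := by
    ext ⟨u, v⟩
    simp only [hconv, R.rel_conv, Set.mem_ofPred_eq, SetRel.mem_inv]
  rel_sup a b := by
    ext ⟨u, v⟩
    simp only [hsup, R.rel_sup, Set.mem_ofPred_eq, Set.mem_union]
  rel_comp a b := by
    have hle (a) : g a ≤ g ⊤ := by rw [← sup_eq_right, ← hsup, sup_top_eq]
    ext ⟨u, v⟩
    simp only [hcomp, R.rel_comp, Set.mem_ofPred_eq, SetRel.mem_comp]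
    constructor
    · rintro ⟨w, h, h'⟩
      refine ⟨⟨w, ?_⟩, h, h'⟩
      -- The intermediate point belongs to the restricted domain: going from `w` back to `u` and
      -- forth again gives a loop at `w` below `g ⊤`.
      have h₁ : (w, u.1) ∈ R.rel (conv (g a)) := by rwa [R.rel_conv, SetRel.mem_inv]
      rw [← hconv] at h₁
      have h₂ := R.rel_comp_mem h₁ h
      rw [← hcomp] at h₂
      exact R.rel_mono (hle _) h₂
    · rintro ⟨w, h, h'⟩
      exact ⟨w, h, h'⟩

end Rep

/-! ### Representations of a product and their two pieces. -/

section Product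

variable {A₁ A₂ : Type} [RelationAlgebra A₁] [RelationAlgebra A₂]

theorem ident_prod : (ident : A₁ × A₂) = (ident, ident) := rfl

theorem conv_prod (a : A₁ × A₂) : conv a = (conv a.1, conv a.2) := rfl

theorem comp_prod (a b : A₁ × A₂) : comp a b = (comp a.1 b.1, comp a.2 b.2) := rfl

namespace Rep

/-- A representation of the first factor is a representation of the product. -/
def ofFst {B : Type} (R : Rep A₁ B) : Rep (A₁ × A₂) B :=
  R.pullback Prod.fst rfl rfl rfl (fun _ => rfl) (fun _ => rfl) (fun _ _ => rfl) (fun _ _ => rfl)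

/-- A representation of the second factor is a representation of the product. -/
def ofSnd {B : Type} (R : Rep A₂ B) : Rep (A₁ × A₂) B :=
  R.pullback Prod.snd rfl rfl rfl (fun _ => rfl) (fun _ => rfl) (fun _ _ => rfl) (fun _ _ => rfl)

/-- The part of a representation of the product that represents the first factor. -/
def fst {B : Type} (R : Rep (A₁ × A₂) B) :
    Rep A₁ {u : B // (u, u) ∈ R.rel ((⊤, ⊥) : A₁ × A₂)} :=
  R.restrict (fun a => (a, ⊥)) rfl (by simp [ident_prod]) (fun a => by ext <;> simp)
    (fun a => by simp [conv_prod, conv_bot]) (fun a b => by simp)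
    (fun a b => by simp [comp_prod, comp_bot])

/-- The part of a representation of the product that represents the second factor. -/
def snd {B : Type} (R : Rep (A₁ × A₂) B) :
    Rep A₂ {u : B // (u, u) ∈ R.rel ((⊥, ⊤) : A₁ × A₂)} :=
  R.restrict (fun a => (⊥, a)) rfl (by simp [ident_prod]) (fun a => by ext <;> simp)
    (fun a => by simp [conv_prod, conv_bot]) (fun a b => by simp)
    (fun a b => by simp [comp_prod, comp_bot])

theorem rel_prod {B : Type} (R : Rep (A₁ × A₂) B) (a : A₁ × A₂) :
    R.rel a = R.rel (a.1, ⊥) ∪ R.rel (⊥, a.2) := by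
  rw [← R.rel_sup]
  simp

/-- The two parts of a representation of a product are not connected to each other. -/
theorem not_mem_fst_snd {B : Type} (R : Rep (A₁ × A₂) B) {u v w : B} {a : A₁} {b : A₂}
    (h : (u, v) ∈ R.rel (a, ⊥)) (h' : (v, w) ∈ R.rel (⊥, b)) : False := by
  have := R.rel_comp_mem h h'
  rw [comp_prod, comp_bot, bot_comp] at this
  simpa [R.rel_bot] using (R.rel_bot ▸ this : (u, w) ∈ (∅ : SetRel B B))

theorem not_mem_snd_fst {B : Type} (R : Rep (A₁ × A₂) B) {u v w : B} {a : A₁} {b : A₂}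
    (h : (u, v) ∈ R.rel (⊥, b)) (h' : (v, w) ∈ R.rel (a, ⊥)) : False := by
  have := R.rel_comp_mem h h'
  rw [comp_prod, comp_bot, bot_comp] at this
  simpa [R.rel_bot] using (R.rel_bot ▸ this : (u, w) ∈ (∅ : SetRel B B))

/-- The loop at the source decides to which piece an edge belongs, as a loop of one piece cannot be
composed with an edge of the other. -/
theorem mem_rel_fst {B : Type} (R : Rep (A₁ × A₂) B) {u v : B} {a : A₁ × A₂}
    (hu : (u, u) ∈ R.rel (⊤, ⊥)) (h : (u, v) ∈ R.rel a) : (u, v) ∈ R.rel (a.1, ⊥) := by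
  rw [R.rel_prod] at h
  exact h.resolve_right fun h => R.not_mem_fst_snd hu h

theorem mem_rel_snd {B : Type} (R : Rep (A₁ × A₂) B) {u v : B} {a : A₁ × A₂}
    (hu : (u, u) ∈ R.rel (⊥, ⊤)) (h : (u, v) ∈ R.rel a) : (u, v) ∈ R.rel (⊥, a.2) := by
  rw [R.rel_prod] at h
  exact h.resolve_left fun h => R.not_mem_snd_fst hu h

end Rep

/-! ### Networks over a product and their encodings. -/

/-- The network obtained by applying a function to all labels. -/
def Network.map {A A' : Type} (g : A → A') (N : Network A) : Network A' where
  n := N.n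
  f x y := g (N.f x y)

theorem Network.encode_map {A A' : Type} (g : A → A') (N : Network A) :
    (N.map g).encode = N.encode.map g := by
  simp [Network.encode, Network.map, List.map_flatMap, Function.comp_def]

theorem Network.satisfiable_prod_iff (N : Network (A₁ × A₂)) :
    N.Satisfiable ↔ (N.map Prod.fst).Satisfiable ∨ (N.map Prod.snd).Satisfiable := by
  constructor
  · rintro ⟨B, R, s, hs⟩
    -- The label of the pair `(x, x)` puts the loop at `s x` into `R.rel ⊤`, hence into one of the
    -- pieces.
    have hmem (x) : (s x, s x) ∈ R.rel (⊤, ⊥) ∨ (s x, s x) ∈ R.rel (⊥, ⊤) := by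
      have := R.rel_mono le_top (hs x x)
      rwa [R.rel_prod] at this
    by_cases h : ∀ x, (s x, s x) ∈ R.rel (⊤, ⊥)
    · exact .inl ⟨_, R.fst, fun x => ⟨s x, h x⟩, fun x y => R.mem_rel_fst (h x) (hs x y)⟩
    -- One variable outside the first piece forces every `y` into the second: otherwise the edge
    -- from `s y` to `s x` would lie in the first piece and could be composed with the loop at `s x`
    -- in the second.
    · obtain ⟨x, hx⟩ := not_forall.1 h
      have h' (y) : (s y, s y) ∈ R.rel (⊥, ⊤) :=
        (hmem y).resolve_left fun hy => R.not_mem_fst_snd (R.mem_rel_fst hy (hs y x))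
          ((hmem x).resolve_left hx)
      exact .inr ⟨_, R.snd, fun x => ⟨s x, h' x⟩, fun x y => R.mem_rel_snd (h' x) (hs x y)⟩
  · rintro (⟨B, R, s, hs⟩ | ⟨B, R, s, hs⟩)
    · exact ⟨B, R.ofFst, s, hs⟩
    · exact ⟨B, R.ofSnd, s, hs⟩

theorem Network.length_encode {A : Type} (N : Network A) : N.encode.length = N.n * N.n := by
  simp [Network.encode]

theorem Network.encode_eq_ofFn {A : Type} (N : Network A) :
    N.encode = List.ofFn fun i : Fin (N.n * N.n) =>
      N.f (finProdFinEquiv.symm i).1 (finProdFinEquiv.symm i).2 := by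
  rw [List.ofFn_mul, Network.encode, List.flatMap_def, ← List.ofFn_eq_map]
  refine congrArg (fun g => (List.ofFn g).flatten) (funext fun x => ?_)
  rw [← List.ofFn_eq_map]
  refine congrArg List.ofFn (funext fun y => ?_)
  -- `finProdFinEquiv` numbers the pairs row by row, which is the order used by the encoding.
  have h (H) : finProdFinEquiv.symm (⟨x * N.n + y, H⟩ : Fin (N.n * N.n)) = (x, y) := by
    rw [Equiv.symm_apply_eq]
    ext
    simp [finProdFinEquiv, add_comm, mul_comm]
  rw [h]

/-- Every word whose length is a square encodes a network. -/
theorem Network.exists_encode_eq {A : Type} (w : List A) (n : ℕ) (hw : w.length = n * n) :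
    ∃ N : Network A, N.encode = w := by
  refine ⟨⟨n, fun x y => w.get (Fin.cast hw.symm (finProdFinEquiv (x, y)))⟩, ?_⟩
  rw [Network.encode_eq_ofFn]
  refine List.ext_get (by simp [hw]) fun i h h' => ?_
  simp [Nat.mod_add_div]

/-- The length `n * n` of the word determines `n`, and then each letter is the label of a known
pair. -/
theorem Network.encode_injective {A : Type} :
    Function.Injective (Network.encode : Network A → List A) := by
  rintro ⟨n, f⟩ ⟨m, g⟩ h
  have hl := congrArg List.length h
  rw [length_encode, length_encode] at hl
  obtain rfl : n = m := Nat.mul_self_inj.1 hl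
  rw [encode_eq_ofFn, encode_eq_ofFn] at h
  have h' := List.ofFn_injective h
  congr 1
  funext x y
  simpa using congrFun h' (finProdFinEquiv (x, y))

theorem mem_NSP_prod_iff (w : List (A₁ × A₂)) :
    w ∈ NSP (A₁ × A₂) ↔ w.map Prod.fst ∈ NSP A₁ ∨ w.map Prod.snd ∈ NSP A₂ := by
  constructor
  · rintro ⟨N, rfl, hN⟩
    rw [← Network.encode_map, ← Network.encode_map]
    exact (N.satisfiable_prod_iff.1 hN).imp (⟨_, rfl, ·⟩) (⟨_, rfl, ·⟩)
  · rintro (⟨N, h, hN⟩ | ⟨N, h, hN⟩) <;>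
    · have hl := congrArg List.length h
      rw [N.length_encode, List.length_map] at hl
      -- Projecting letters preserves the length, so `w` has square length and encodes a network
      -- itself; by injectivity `N` must be its projection.
      obtain ⟨N', rfl⟩ := Network.exists_encode_eq w N.n hl.symm
      rw [← Network.encode_map] at h
      cases Network.encode_injective h
      refine ⟨N', rfl, N'.satisfiable_prod_iff.2 ?_⟩
      first | exact .inl hN | exact .inr hN

end Product

/-! ### Computation paths of nondeterministic machines. -/

open Turing

namespace NTM

/-- Every computation path from `c` has at most `T` steps. -/
def Bounded (M : NTM) (T : ℕ) (c : M.toFinTM2.Cfg) : Prop :=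
  ∀ k d, M.Run k c d → k ≤ T

/-- Some computation path leads from `c` to the halting configuration `d`. -/
def HaltsAt (M : NTM) (c d : M.toFinTM2.Cfg) : Prop :=
  (∃ k, M.Run k c d) ∧ d.l = none

variable {M : NTM}

theorem not_step_of_halted {c d : M.toFinTM2.Cfg} (h : c.l = none) : ¬ M.Step c d := by
  obtain ⟨l, v, S⟩ := c
  cases h
  rintro (h | h) <;> simp at h

theorem exists_step {c : M.toFinTM2.Cfg} (h : c.l ≠ none) : ∃ d, M.Step c d := by
  obtain ⟨_ | l, v, S⟩ := c
  · exact absurd rfl h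
  · exact ⟨_, .inl rfl⟩

theorem bounded_of_halted {c : M.toFinTM2.Cfg} (h : c.l = none) : M.Bounded 0 c := by
  rintro (_ | k) d hd
  · exact le_rfl
  · obtain ⟨e, he, -⟩ := hd
    exact absurd he (not_step_of_halted h)

theorem haltsAt_of_halted {c d : M.toFinTM2.Cfg} (h : c.l = none) : M.HaltsAt c d ↔ d = c := by
  constructor
  · rintro ⟨⟨_ | k, hd⟩, -⟩
    · exact Eq.symm hd
    · obtain ⟨e, he, -⟩ := hd
      exact absurd he (not_step_of_halted h)
  · rintro rfl
    exact ⟨⟨0, rfl⟩, h⟩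

theorem bounded_succ {T : ℕ} {c : M.toFinTM2.Cfg} (h : ∀ d, M.Step c d → M.Bounded T d) :
    M.Bounded (T + 1) c := by
  rintro (_ | k) d hd
  · exact Nat.zero_le _
  · obtain ⟨e, he, hd⟩ := hd
    exact Nat.succ_le_succ (h e he k d hd)

theorem Bounded.of_step {T : ℕ} {c d : M.toFinTM2.Cfg} (h : M.Bounded (T + 1) c)
    (hd : M.Step c d) : M.Bounded T d :=
  fun k e he => Nat.le_of_succ_le_succ (h (k + 1) e ⟨d, hd, he⟩)

theorem Bounded.halted {c : M.toFinTM2.Cfg} (h : M.Bounded 0 c) : c.l = none := by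
  by_contra hc
  obtain ⟨d, hd⟩ := exists_step hc
  exact absurd (h 1 d ⟨d, hd, rfl⟩) (by simp)

theorem haltsAt_iff_step {c d : M.toFinTM2.Cfg} (hc : c.l ≠ none) :
    M.HaltsAt c d ↔ ∃ e, M.Step c e ∧ M.HaltsAt e d := by
  constructor
  · rintro ⟨⟨_ | k, hd⟩, h⟩
    · cases hd
      exact absurd h hc
    · obtain ⟨e, he, hd⟩ := hd
      exact ⟨e, he, ⟨k, hd⟩, h⟩
  · rintro ⟨e, he, ⟨k, hd⟩, h⟩
    exact ⟨⟨k + 1, e, he, hd⟩, h⟩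

/-- A configuration with only one successor takes one step more than the successor. -/
theorem bounded_of_step_iff {T : ℕ} {c c' : M.toFinTM2.Cfg} (h : ∀ d, M.Step c d ↔ d = c')
    (hc : M.Bounded T c') : M.Bounded (T + 1) c :=
  bounded_succ fun _ hd => (h _).1 hd ▸ hc

theorem haltsAt_of_step_iff {c c' d : M.toFinTM2.Cfg} (h : ∀ d, M.Step c d ↔ d = c') :
    M.HaltsAt c d ↔ M.HaltsAt c' d := by
  have hc : c.l ≠ none := fun hc => not_step_of_halted hc ((h c').2 rfl)
  simp [haltsAt_iff_step hc, h]

/-- If `M'` simulates `M` step by step, the time bounds add up. -/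
theorem bounded_of_simulation {M' : NTM} (emb : M.toFinTM2.Cfg → M'.toFinTM2.Cfg)
    (hstep : ∀ c d, c.l ≠ none → (M'.Step (emb c) d ↔ ∃ e, M.Step c e ∧ d = emb e))
    {T T' : ℕ} {c : M.toFinTM2.Cfg} (hc : M.Bounded T c)
    (hT' : ∀ d, M.HaltsAt c d → M'.Bounded T' (emb d)) : M'.Bounded (T + T') (emb c) := by
  induction T generalizing c with
  | zero =>
    rw [Nat.zero_add]
    exact hT' c ((haltsAt_of_halted hc.halted).2 rfl)
  | succ T ih =>
    by_cases h : c.l = none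
    · exact fun k d hd => (hT' c ((haltsAt_of_halted h).2 rfl) k d hd).trans (Nat.le_add_left _ _)
    · rw [Nat.add_right_comm]
      refine bounded_succ fun d hd => ?_
      obtain ⟨e, he, rfl⟩ := (hstep c d h).1 hd
      exact ih (hc.of_step he) fun d hd => hT' d ((haltsAt_iff_step h).2 ⟨e, he, hd⟩)

/-- If `M'` simulates `M` step by step, it continues where `M` halts. -/
theorem haltsAt_of_simulation {M' : NTM} (emb : M.toFinTM2.Cfg → M'.toFinTM2.Cfg)
    (hemb : ∀ c, (emb c).l ≠ none)
    (hstep : ∀ c d, c.l ≠ none → (M'.Step (emb c) d ↔ ∃ e, M.Step c e ∧ d = emb e))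
    {T : ℕ} {c : M.toFinTM2.Cfg} (hc : M.Bounded T c) (d : M'.toFinTM2.Cfg) :
    M'.HaltsAt (emb c) d ↔ ∃ e, M.HaltsAt c e ∧ M'.HaltsAt (emb e) d := by
  induction T generalizing c with
  | zero => simp [haltsAt_of_halted hc.halted]
  | succ T ih =>
    by_cases h : c.l = none
    · simp [haltsAt_of_halted h]
    · rw [haltsAt_iff_step (hemb c)]
      simp only [hstep c _ h, haltsAt_iff_step h]
      constructor
      · rintro ⟨_, ⟨e, he, rfl⟩, hd⟩
        obtain ⟨e', he', hd⟩ := (ih (hc.of_step he)).1 hd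
        exact ⟨e', ⟨e, he, he'⟩, hd⟩
      · rintro ⟨e', ⟨e, he, he'⟩, hd⟩
        exact ⟨_, ⟨e, he, rfl⟩, (ih (hc.of_step he)).2 ⟨e', he', hd⟩⟩

/-- A deterministic machine as a nondeterministic one. -/
def ofDet (M : FinTM2) : NTM := { M with m' := M.m }

theorem step_ofDet (M : FinTM2) (c d : M.Cfg) : (ofDet M).Step c d ↔ M.step c = some d :=
  or_self_iff

theorem iterate_bind_none {σ : Type*} (f : σ → Option σ) (k : ℕ) :
    (flip bind f)^[k] none = none :=
  Function.iterate_fixed rfl k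

theorem run_ofDet (M : FinTM2) (k : ℕ) (c d : M.Cfg) :
    (ofDet M).Run k c d ↔ (flip bind M.step)^[k] (some c) = some d := by
  induction k generalizing c with
  | zero => exact ⟨fun h => congrArg some h, fun h => Option.some_injective _ h⟩
  | succ k ih =>
    have e : (flip bind M.step)^[k + 1] (some c) = (flip bind M.step)^[k] (M.step c) := rfl
    rw [e]
    constructor
    · rintro ⟨e, he, hd⟩
      rw [(step_ofDet M c e).1 he]
      exact (ih e).1 hd
    · intro h
      cases hc : M.step c with
      | none =>
        rw [hc, iterate_bind_none] at h
        cases h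
      | some e =>
        rw [hc] at h
        exact ⟨e, (step_ofDet M c e).2 hc, (ih e).2 h⟩

/-- With a single successor at each step, one halting run is the only maximal run, so it bounds all
paths and fixes the result. -/
theorem run_unique (M : FinTM2) {k : ℕ} {c d : M.Cfg} (h : (ofDet M).Run k c d)
    (hd : d.l = none) : (ofDet M).Bounded k c ∧ ∀ e, (ofDet M).HaltsAt c e ↔ e = d := by
  induction k generalizing c with
  | zero =>
    cases h
    exact ⟨bounded_of_halted hd, fun e => haltsAt_of_halted hd⟩
  | succ k ih =>
    obtain ⟨e, he, h⟩ := h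
    have hs (d) : (ofDet M).Step c d ↔ d = e := by
      refine (step_ofDet M c d).trans ?_
      rw [(step_ofDet M c e).1 he]
      exact Option.some_inj.trans eq_comm
    exact ⟨bounded_of_step_iff hs (ih h).1, fun d => (haltsAt_of_step_iff hs).trans ((ih h).2 d)⟩

end NTM

/-! ### Construction of the union machine. -/

/-- The translation of a statement to a machine with more stacks, more labels and a larger
internal state, where halting is replaced by a jump to `exit`. -/
def liftStmt {K K' : Type} {Γ' : K' → Type} {Λ Λ' σ σ' : Type} (ι : K → K') (get : σ' → σ)
    (set : σ → σ' → σ') (lab : Λ → Λ') (exit : Λ') :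
    TM2.Stmt (fun k => Γ' (ι k)) Λ σ → TM2.Stmt Γ' Λ' σ'
  | .push k f q => .push (ι k) (fun s => f (get s)) (liftStmt ι get set lab exit q)
  | .peek k f q => .peek (ι k) (fun s x => set (f (get s) x) s) (liftStmt ι get set lab exit q)
  | .pop k f q => .pop (ι k) (fun s x => set (f (get s) x) s) (liftStmt ι get set lab exit q)
  | .load f q => .load (fun s => set (f (get s)) s) (liftStmt ι get set lab exit q)
  | .branch f q q' => .branch (fun s => f (get s)) (liftStmt ι get set lab exit q)
      (liftStmt ι get set lab exit q')
  | .goto f => .goto fun s => lab (f (get s))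
  | .halt => .goto fun _ => exit

/-- Here `g` and `o` insert a state and stacks into fixed surroundings. Every elementary statement
only changes the inserted part, so the surroundings survive the induction. A halt becomes a move to
`exit` within the same step. -/
theorem stepAux_liftStmt {K K' : Type} [DecidableEq K] [DecidableEq K'] {Γ' : K' → Type}
    {Λ Λ' σ σ' : Type} (ι : K → K') (get : σ' → σ) (set : σ → σ' → σ') (lab : Λ → Λ') (exit : Λ')
    (g : σ → σ') (o : (∀ k, List (Γ' (ι k))) → ∀ k, List (Γ' k)) (hget : ∀ s, get (g s) = s)
    (hset : ∀ s t, set t (g s) = g t) (ho : ∀ S k, o S (ι k) = S k)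
    (hupd : ∀ S k x, Function.update (o S) (ι k) x = o (Function.update S k x))
    (q : TM2.Stmt (fun k => Γ' (ι k)) Λ σ) (v : σ) (S : ∀ k, List (Γ' (ι k))) :
    TM2.stepAux (liftStmt ι get set lab exit q) (g v) (o S) =
      ⟨some ((TM2.stepAux q v S).l.elim exit lab), g (TM2.stepAux q v S).var,
        o (TM2.stepAux q v S).stk⟩ := by
  induction q generalizing v S with
  | push k f q ih => simp only [liftStmt, TM2.stepAux, hget, ho, hupd, ih]
  | peek k f q ih => simp only [liftStmt, TM2.stepAux, hget, hset, ho, ih]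
  | pop k f q ih => simp only [liftStmt, TM2.stepAux, hget, hset, ho, hupd, ih]
  | load f q ih => simp only [liftStmt, TM2.stepAux, hget, hset, ih]
  | branch f q q' ih ih' =>
    simp only [liftStmt, TM2.stepAux, hget]
    cases f v
    · exact ih' v S
    · exact ih v S
  | goto f => simp only [liftStmt, TM2.stepAux, hget, Option.elim_some]
  | halt => rfl

/-- The stacks of a machine that runs two machines on images of its input. -/
inductive UnionStack (K₁ K₂ : Type)
  | input
  | temp
  | output
  | fst (k : K₁)
  | snd (k : K₂)
  deriving DecidableEq, Fintype

/-- The labels of a machine that runs two machines on images of its input. -/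
inductive UnionLabel (Λ₁ Λ₂ : Type)
  | unload
  | load
  | fst (l : Λ₁)
  | snd (l : Λ₂)
  | finish
  deriving Fintype

/-- The internal state of a machine that runs two machines on images of its input. -/
structure UnionState (σ₁ σ₂ Γ : Type) where
  fst : σ₁
  snd : σ₂
  buffer : Option Γ
  acc₁ : Bool
  acc₂ : Bool
  deriving Fintype

/-- The stack alphabets of a machine that runs two machines on images of its input. -/
abbrev UnionStack.Alphabet {K₁ K₂ : Type} (Γ : Type) (Γ₁ : K₁ → Type) (Γ₂ : K₂ → Type) :
    UnionStack K₁ K₂ → Type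
  | input => Γ
  | temp => Γ
  | output => Bool
  | fst k => Γ₁ k
  | snd k => Γ₂ k

/-- The combination of the stack contents of two machines with an input stack, an auxiliary stack
and an output stack. -/
def unionStacks {K₁ K₂ Γ : Type} {Γ₁ : K₁ → Type} {Γ₂ : K₂ → Type} (i t : List Γ) (o : List Bool)
    (S₁ : ∀ k, List (Γ₁ k)) (S₂ : ∀ k, List (Γ₂ k)) :
    ∀ k : UnionStack K₁ K₂, List (k.Alphabet Γ Γ₁ Γ₂)
  | .input => i
  | .temp => t
  | .output => o
  | .fst k => S₁ k
  | .snd k => S₂ k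

section Update

variable {K₁ K₂ Γ : Type} {Γ₁ : K₁ → Type} {Γ₂ : K₂ → Type} [DecidableEq K₁] [DecidableEq K₂]
  (i t : List Γ) (o : List Bool) (S₁ : ∀ k, List (Γ₁ k)) (S₂ : ∀ k, List (Γ₂ k))

theorem update_unionStacks_input (i' : List Γ) :
    Function.update (unionStacks i t o S₁ S₂) .input i' = unionStacks i' t o S₁ S₂ := by
  funext k
  cases k <;> simp [Function.update, unionStacks]

theorem update_unionStacks_temp (t' : List Γ) :
    Function.update (unionStacks i t o S₁ S₂) .temp t' = unionStacks i t' o S₁ S₂ := by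
  funext k
  cases k <;> simp [Function.update, unionStacks]

theorem update_unionStacks_output (o' : List Bool) :
    Function.update (unionStacks i t o S₁ S₂) .output o' = unionStacks i t o' S₁ S₂ := by
  funext k
  cases k <;> simp [Function.update, unionStacks]

theorem update_unionStacks_fst (k : K₁) (x : List (Γ₁ k)) :
    Function.update (unionStacks i t o S₁ S₂) (.fst k) x =
      unionStacks i t o (Function.update S₁ k x) S₂ := by
  funext k'
  rcases k' with _ | _ | _ | k' | k'
  · simp [unionStacks]
  · simp [unionStacks]
  · simp [unionStacks]
  · by_cases h : k' = k
    · subst h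
      simp [unionStacks]
    · simp [unionStacks, h]
  · simp [unionStacks]

theorem update_unionStacks_snd (k : K₂) (x : List (Γ₂ k)) :
    Function.update (unionStacks i t o S₁ S₂) (.snd k) x =
      unionStacks i t o S₁ (Function.update S₂ k x) := by
  funext k'
  rcases k' with _ | _ | _ | k' | k'
  · simp [unionStacks]
  · simp [unionStacks]
  · simp [unionStacks]
  · simp [unionStacks]
  · by_cases h : k' = k
    · subst h
      simp [unionStacks]
    · simp [unionStacks, h]

end Update

/-- Whether a list consists of a single element which `o` maps to `true`. -/
def isAccepting {Γ : Type} (o : Γ → Bool) (l : List Γ) : Bool :=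
  (l.head?.map o == some true) && l.tail.head?.isNone

theorem isAccepting_iff {Γ : Type} (o : Γ ≃ Bool) (l : List Γ) :
    isAccepting o l = true ↔ l = [o.symm true] := by
  rcases l with _ | ⟨a, _ | ⟨b, l⟩⟩ <;> simp [isAccepting, Equiv.eq_symm_apply]

section Machine

variable (M₁ M₂ : NTM) {Γ : Type}

/-- The stack alphabets of the union of two machines. -/
abbrev UnionAlphabet (Γ : Type) : UnionStack M₁.K M₂.K → Type :=
  UnionStack.Alphabet Γ M₁.Γ M₂.Γ

/-- The initial internal state of the union of two machines. -/
def unionInit (Γ : Type) : UnionState M₁.σ M₂.σ Γ :=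
  ⟨M₁.initialState, M₂.initialState, none, false, false⟩

/-- The program that translates the input by `e₁` and `e₂`, runs the programs `p₁` and `p₂` on the
results, and outputs the disjunction of their answers, as read off by `o₁` and `o₂`. -/
def unionProgram [Inhabited Γ] (e₁ : Γ → M₁.Γ M₁.k₀) (e₂ : Γ → M₂.Γ M₂.k₀)
    (o₁ : M₁.Γ M₁.k₁ → Bool) (o₂ : M₂.Γ M₂.k₁ → Bool)
    (p₁ : M₁.Λ → TM2.Stmt M₁.Γ M₁.Λ M₁.σ) (p₂ : M₂.Λ → TM2.Stmt M₂.Γ M₂.Λ M₂.σ) :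
    UnionLabel M₁.Λ M₂.Λ →
      TM2.Stmt (UnionAlphabet M₁ M₂ Γ) (UnionLabel M₁.Λ M₂.Λ) (UnionState M₁.σ M₂.σ Γ)
  | .unload => .pop .input (fun s x => { s with buffer := x }) <|
      .branch (fun s => s.buffer.isSome)
        (.push .temp (fun s => (s.buffer.getD default : Γ)) <| .goto fun _ => .unload)
        (.goto fun _ => .load)
  | .load => .pop .temp (fun s x => { s with buffer := x }) <|
      .branch (fun s => s.buffer.isSome)
        (.push (.fst M₁.k₀) (fun s => e₁ (s.buffer.getD default)) <|
          .push (.snd M₂.k₀) (fun s => e₂ (s.buffer.getD default)) <| .goto fun _ => .load)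
        (.goto fun _ => .fst M₁.main)
  | .fst l => liftStmt (Γ' := UnionAlphabet M₁ M₂ Γ) UnionStack.fst UnionState.fst
      (fun v s => { s with fst := v }) UnionLabel.fst (.snd M₂.main) (p₁ l)
  | .snd l => liftStmt (Γ' := UnionAlphabet M₁ M₂ Γ) UnionStack.snd UnionState.snd
      (fun v s => { s with snd := v }) UnionLabel.snd .finish (p₂ l)
  | .finish =>
      .pop (.fst M₁.k₁) (fun s x => { s with acc₁ := x.map o₁ == some true }) <|
      .pop (.fst M₁.k₁) (fun s x => { s with acc₁ := s.acc₁ && x.isNone }) <|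
      .pop (.snd M₂.k₁) (fun s x => { s with acc₂ := x.map o₂ == some true }) <|
      .pop (.snd M₂.k₁) (fun s x => { s with acc₂ := s.acc₂ && x.isNone }) <|
      .push .output (fun s => (s.acc₁ || s.acc₂ : Bool)) <|
      .load (fun _ => unionInit M₁ M₂ Γ) .halt

/-- The machine that translates the input by `e₁` and `e₂`, runs `M₁` and `M₂` on the results, and
outputs the disjunction of their answers. -/
def unionNTM [Fintype Γ] [Inhabited Γ] (e₁ : Γ → M₁.Γ M₁.k₀) (e₂ : Γ → M₂.Γ M₂.k₀)
    (o₁ : M₁.Γ M₁.k₁ → Bool) (o₂ : M₂.Γ M₂.k₁ → Bool) : NTM :=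
  haveI := M₁.kFin
  haveI := M₂.kFin
  haveI := M₁.ΛFin
  haveI := M₂.ΛFin
  haveI := M₁.σFin
  haveI := M₂.σFin
  { K := UnionStack M₁.K M₂.K
    k₀ := .input
    k₁ := .output
    Γ := UnionAlphabet M₁ M₂ Γ
    Λ := UnionLabel M₁.Λ M₂.Λ
    main := .unload
    σ := UnionState M₁.σ M₂.σ Γ
    initialState := unionInit M₁ M₂ Γ
    Γk₀Fin := inferInstanceAs (Fintype Γ)
    m := unionProgram M₁ M₂ e₁ e₂ o₁ o₂ M₁.m M₂.m
    m' := unionProgram M₁ M₂ e₁ e₂ o₁ o₂ M₁.m' M₂.m' }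

variable [Fintype Γ] [Inhabited Γ] (e₁ : Γ → M₁.Γ M₁.k₀) (e₂ : Γ → M₂.Γ M₂.k₀)
    (o₁ : M₁.Γ M₁.k₁ → Bool) (o₂ : M₂.Γ M₂.k₁ → Bool)

/-- A configuration of the union machine, given by a label and its components. -/
def unionCfg (l : Option (UnionLabel M₁.Λ M₂.Λ)) (v : UnionState M₁.σ M₂.σ Γ)
    (i t : List Γ) (o : List Bool) (S₁ : ∀ k, List (M₁.Γ k)) (S₂ : ∀ k, List (M₂.Γ k)) :
    (unionNTM M₁ M₂ e₁ e₂ o₁ o₂).Cfg :=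
  (⟨l, v, unionStacks i t o S₁ S₂⟩ :
    TM2.Cfg (UnionAlphabet M₁ M₂ Γ) (UnionLabel M₁.Λ M₂.Λ) (UnionState M₁.σ M₂.σ Γ))

theorem unionNTM_step_iff (l : UnionLabel M₁.Λ M₂.Λ) (v : UnionState M₁.σ M₂.σ Γ)
    (i t : List Γ) (o : List Bool) (S₁ : ∀ k, List (M₁.Γ k)) (S₂ : ∀ k, List (M₂.Γ k))
    (d : (unionNTM M₁ M₂ e₁ e₂ o₁ o₂).Cfg) :
    (unionNTM M₁ M₂ e₁ e₂ o₁ o₂).Step (unionCfg M₁ M₂ e₁ e₂ o₁ o₂ (some l) v i t o S₁ S₂) d ↔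
      TM2.stepAux (unionProgram M₁ M₂ e₁ e₂ o₁ o₂ M₁.m M₂.m l) v (unionStacks i t o S₁ S₂) = d ∨
      TM2.stepAux (unionProgram M₁ M₂ e₁ e₂ o₁ o₂ M₁.m' M₂.m' l) v (unionStacks i t o S₁ S₂) = d :=
  or_congr Option.some_inj Option.some_inj

/-- Copying the input and evaluating the answers do not involve the component programs, so both
programs of the union machine act alike and the successor is unique. -/
theorem unionNTM_step_iff_eq {l : UnionLabel M₁.Λ M₂.Λ} {v : UnionState M₁.σ M₂.σ Γ}
    {i t : List Γ} {o : List Bool} {S₁ : ∀ k, List (M₁.Γ k)} {S₂ : ∀ k, List (M₂.Γ k)}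
    {c : TM2.Cfg (UnionAlphabet M₁ M₂ Γ) (UnionLabel M₁.Λ M₂.Λ) (UnionState M₁.σ M₂.σ Γ)}
    (h : ∀ p₁ p₂, TM2.stepAux (unionProgram M₁ M₂ e₁ e₂ o₁ o₂ p₁ p₂ l) v
      (unionStacks i t o S₁ S₂) = c) (d : (unionNTM M₁ M₂ e₁ e₂ o₁ o₂).Cfg) :
    (unionNTM M₁ M₂ e₁ e₂ o₁ o₂).Step (unionCfg M₁ M₂ e₁ e₂ o₁ o₂ (some l) v i t o S₁ S₂) d ↔
      d = c := by
  refine (unionNTM_step_iff M₁ M₂ e₁ e₂ o₁ o₂ l v i t o S₁ S₂ d).trans ?_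
  rw [h, h]
  exact (or_self_iff).trans eq_comm

/-- A configuration of the union machine while it empties its input stack. -/
def unloadCfg (b : Option Γ) (i t : List Γ) : (unionNTM M₁ M₂ e₁ e₂ o₁ o₂).Cfg :=
  unionCfg M₁ M₂ e₁ e₂ o₁ o₂ (some .unload) { unionInit M₁ M₂ Γ with buffer := b } i t []
    (fun _ => []) (fun _ => [])

/-- A configuration of the union machine while it prepares the inputs of its components. -/
def loadCfg (b : Option Γ) (t w : List Γ) : (unionNTM M₁ M₂ e₁ e₂ o₁ o₂).Cfg :=
  unionCfg M₁ M₂ e₁ e₂ o₁ o₂ (some .load) { unionInit M₁ M₂ Γ with buffer := b } [] t []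
    (Function.update (fun _ => []) M₁.k₀ (w.map e₁))
    (Function.update (fun _ => []) M₂.k₀ (w.map e₂))

/-- The configuration of the union machine while the first component is running. -/
def fstCfg (S₂ : ∀ k, List (M₂.Γ k)) (c : M₁.Cfg) : (unionNTM M₁ M₂ e₁ e₂ o₁ o₂).Cfg :=
  unionCfg M₁ M₂ e₁ e₂ o₁ o₂ (some (c.l.elim (.snd M₂.main) .fst))
    { unionInit M₁ M₂ Γ with fst := c.var } [] [] [] c.stk S₂

/-- The configuration of the union machine while the second component is running. -/
def sndCfg (v₁ : M₁.σ) (S₁ : ∀ k, List (M₁.Γ k)) (c : M₂.Cfg) :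
    (unionNTM M₁ M₂ e₁ e₂ o₁ o₂).Cfg :=
  unionCfg M₁ M₂ e₁ e₂ o₁ o₂ (some (c.l.elim .finish .snd))
    { unionInit M₁ M₂ Γ with fst := v₁, snd := c.var } [] [] [] S₁ c.stk

/-- The halting configuration of the union machine. -/
def finalCfg (S₁ : ∀ k, List (M₁.Γ k)) (S₂ : ∀ k, List (M₂.Γ k)) :
    (unionNTM M₁ M₂ e₁ e₂ o₁ o₂).Cfg :=
  unionCfg M₁ M₂ e₁ e₂ o₁ o₂ none (unionInit M₁ M₂ Γ) [] []
    [isAccepting o₁ (S₁ M₁.k₁) || isAccepting o₂ (S₂ M₂.k₁)]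
    (Function.update S₁ M₁.k₁ (S₁ M₁.k₁).tail.tail)
    (Function.update S₂ M₂.k₁ (S₂ M₂.k₁).tail.tail)

variable {M₁ M₂} {e₁ e₂ o₁ o₂}

theorem step_unloadCfg_cons (b : Option Γ) (a : Γ) (i t : List Γ) (d) :
    (unionNTM M₁ M₂ e₁ e₂ o₁ o₂).Step (unloadCfg M₁ M₂ e₁ e₂ o₁ o₂ b (a :: i) t) d ↔
      d = unloadCfg M₁ M₂ e₁ e₂ o₁ o₂ (some a) i (a :: t) := by
  refine unionNTM_step_iff_eq _ _ _ _ _ _ (fun p₁ p₂ => ?_) d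
  simp only [unionProgram, TM2.stepAux, update_unionStacks_input]
  exact congrArg (TM2.Cfg.mk _ _) (update_unionStacks_temp _ _ _ _ _ _)

theorem step_unloadCfg_nil (b : Option Γ) (t : List Γ) (d) :
    (unionNTM M₁ M₂ e₁ e₂ o₁ o₂).Step (unloadCfg M₁ M₂ e₁ e₂ o₁ o₂ b [] t) d ↔
      d = loadCfg M₁ M₂ e₁ e₂ o₁ o₂ none t [] := by
  refine unionNTM_step_iff_eq _ _ _ _ _ _ (fun p₁ p₂ => ?_) d
  simp only [unionProgram, TM2.stepAux, update_unionStacks_input]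
  simp [loadCfg, unionCfg, unionStacks]

theorem step_loadCfg_cons (b : Option Γ) (a : Γ) (t w : List Γ) (d) :
    (unionNTM M₁ M₂ e₁ e₂ o₁ o₂).Step (loadCfg M₁ M₂ e₁ e₂ o₁ o₂ b (a :: t) w) d ↔
      d = loadCfg M₁ M₂ e₁ e₂ o₁ o₂ (some a) t (a :: w) := by
  refine unionNTM_step_iff_eq _ _ _ _ _ _ (fun p₁ p₂ => ?_) d
  simp only [unionProgram, TM2.stepAux, update_unionStacks_temp]
  simp [loadCfg, unionCfg, unionStacks, update_unionStacks_fst, update_unionStacks_snd]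

theorem step_loadCfg_nil (b : Option Γ) (w : List Γ) (d) :
    (unionNTM M₁ M₂ e₁ e₂ o₁ o₂).Step (loadCfg M₁ M₂ e₁ e₂ o₁ o₂ b [] w) d ↔
      d = fstCfg M₁ M₂ e₁ e₂ o₁ o₂ (Function.update (fun _ => []) M₂.k₀ (w.map e₂))
        (⟨some M₁.main, M₁.initialState, Function.update (fun _ => []) M₁.k₀ (w.map e₁)⟩ :
          TM2.Cfg M₁.Γ M₁.Λ M₁.σ) := by
  refine unionNTM_step_iff_eq _ _ _ _ _ _ (fun p₁ p₂ => ?_) d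
  simp only [unionProgram, TM2.stepAux, update_unionStacks_temp]
  rfl

theorem stepAux_fst (p₁ p₂) (l : M₁.Λ) (v : M₁.σ) (S₁ : ∀ k, List (M₁.Γ k))
    (S₂ : ∀ k, List (M₂.Γ k)) :
    TM2.stepAux (unionProgram M₁ M₂ e₁ e₂ o₁ o₂ p₁ p₂ (.fst l))
      { unionInit M₁ M₂ Γ with fst := v } (unionStacks [] [] [] S₁ S₂) =
      fstCfg M₁ M₂ e₁ e₂ o₁ o₂ S₂ (TM2.stepAux (p₁ l) v S₁) :=
  stepAux_liftStmt (Γ' := UnionAlphabet M₁ M₂ Γ) UnionStack.fst UnionState.fst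
    (fun v s => { s with fst := v }) UnionLabel.fst (.snd M₂.main)
    (fun v => { unionInit M₁ M₂ Γ with fst := v }) (fun S : ∀ k, List (M₁.Γ k) => unionStacks [] [] [] S S₂)
    (fun _ => rfl) (fun _ _ => rfl) (fun _ _ => rfl)
    (fun _ _ _ => update_unionStacks_fst _ _ _ _ _ _ _) _ _ _

theorem stepAux_snd (p₁ p₂) (l : M₂.Λ) (v₁ : M₁.σ) (v : M₂.σ) (S₁ : ∀ k, List (M₁.Γ k))
    (S₂ : ∀ k, List (M₂.Γ k)) :
    TM2.stepAux (unionProgram M₁ M₂ e₁ e₂ o₁ o₂ p₁ p₂ (.snd l))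
      { unionInit M₁ M₂ Γ with fst := v₁, snd := v } (unionStacks [] [] [] S₁ S₂) =
      sndCfg M₁ M₂ e₁ e₂ o₁ o₂ v₁ S₁ (TM2.stepAux (p₂ l) v S₂) :=
  stepAux_liftStmt (Γ' := UnionAlphabet M₁ M₂ Γ) UnionStack.snd UnionState.snd
    (fun v s => { s with snd := v }) UnionLabel.snd .finish
    (fun v => { unionInit M₁ M₂ Γ with fst := v₁, snd := v }) (fun S : ∀ k, List (M₂.Γ k) => unionStacks [] [] [] S₁ S)
    (fun _ => rfl) (fun _ _ => rfl) (fun _ _ => rfl)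
    (fun _ _ _ => update_unionStacks_snd _ _ _ _ _ _ _) _ _ _

theorem eq_or_eq_iff_exists {α β : Type*} (g : α → β) (a a' : α) (d : β) :
    g a = d ∨ g a' = d ↔ ∃ e, (a = e ∨ a' = e) ∧ d = g e := by
  simp [or_and_right, exists_or, eq_comm]

theorem step_fstCfg (S₂ : ∀ k, List (M₂.Γ k)) (c : M₁.Cfg) (d) (hc : c.l ≠ none) :
    (unionNTM M₁ M₂ e₁ e₂ o₁ o₂).Step (fstCfg M₁ M₂ e₁ e₂ o₁ o₂ S₂ c) d ↔
      ∃ e, M₁.Step c e ∧ d = fstCfg M₁ M₂ e₁ e₂ o₁ o₂ S₂ e := by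
  obtain ⟨_ | l, v, S₁⟩ := c
  · exact absurd rfl hc
  · have h : M₁.Step ⟨some l, v, S₁⟩ = fun e => TM2.stepAux (M₁.m l) v S₁ = e ∨
        TM2.stepAux (M₁.m' l) v S₁ = e := by
      funext e
      exact propext (or_congr Option.some_inj Option.some_inj)
    refine (unionNTM_step_iff M₁ M₂ e₁ e₂ o₁ o₂ (.fst l) _ _ _ _ _ _ d).trans ?_
    erw [stepAux_fst, stepAux_fst]
    rw [h]
    exact eq_or_eq_iff_exists _ _ _ _

theorem step_sndCfg (v₁ : M₁.σ) (S₁ : ∀ k, List (M₁.Γ k)) (c : M₂.Cfg) (d) (hc : c.l ≠ none) :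
    (unionNTM M₁ M₂ e₁ e₂ o₁ o₂).Step (sndCfg M₁ M₂ e₁ e₂ o₁ o₂ v₁ S₁ c) d ↔
      ∃ e, M₂.Step c e ∧ d = sndCfg M₁ M₂ e₁ e₂ o₁ o₂ v₁ S₁ e := by
  obtain ⟨_ | l, v, S₂⟩ := c
  · exact absurd rfl hc
  · have h : M₂.Step ⟨some l, v, S₂⟩ = fun e => TM2.stepAux (M₂.m l) v S₂ = e ∨
        TM2.stepAux (M₂.m' l) v S₂ = e := by
      funext e
      exact propext (or_congr Option.some_inj Option.some_inj)
    refine (unionNTM_step_iff M₁ M₂ e₁ e₂ o₁ o₂ (.snd l) _ _ _ _ _ _ d).trans ?_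
    erw [stepAux_snd, stepAux_snd]
    rw [h]
    exact eq_or_eq_iff_exists _ _ _ _

theorem step_finish (v : UnionState M₁.σ M₂.σ Γ) (S₁ : ∀ k, List (M₁.Γ k))
    (S₂ : ∀ k, List (M₂.Γ k)) (d) :
    (unionNTM M₁ M₂ e₁ e₂ o₁ o₂).Step
        (unionCfg M₁ M₂ e₁ e₂ o₁ o₂ (some .finish) v [] [] [] S₁ S₂) d ↔
      d = finalCfg M₁ M₂ e₁ e₂ o₁ o₂ S₁ S₂ := by
  refine unionNTM_step_iff_eq _ _ _ _ _ _ (fun p₁ p₂ => ?_) d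
  simp only [unionProgram, TM2.stepAux, update_unionStacks_fst, update_unionStacks_snd]
  simp [finalCfg, unionCfg, unionStacks, isAccepting, update_unionStacks_output]

theorem initList_eq (tm : FinTM2) (s : List (tm.Γ tm.k₀)) :
    initList tm s = (⟨some tm.main, tm.initialState, Function.update (fun _ => []) tm.k₀ s⟩ :
      TM2.Cfg tm.Γ tm.Λ tm.σ) := by
  refine congrArg (TM2.Cfg.mk _ _) (funext fun k => ?_)
  by_cases h : k = tm.k₀
  · subst h
    simp
  · simp [h]

theorem haltList_eq (tm : FinTM2) (s : List (tm.Γ tm.k₁)) :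
    haltList tm s = (⟨none, tm.initialState, Function.update (fun _ => []) tm.k₁ s⟩ :
      TM2.Cfg tm.Γ tm.Λ tm.σ) := by
  refine congrArg (TM2.Cfg.mk _ _) (funext fun k => ?_)
  by_cases h : k = tm.k₁
  · subst h
    simp
  · simp [h]

theorem initList_unionNTM (w : List Γ) :
    initList (unionNTM M₁ M₂ e₁ e₂ o₁ o₂).toFinTM2 w =
      unloadCfg M₁ M₂ e₁ e₂ o₁ o₂ none w [] := by
  refine (initList_eq _ _).trans (congrArg (TM2.Cfg.mk _ _) (funext fun k => ?_))
  cases k <;> rfl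

theorem haltList_unionNTM (b : Bool) :
    haltList (unionNTM M₁ M₂ e₁ e₂ o₁ o₂).toFinTM2 [b] =
      unionCfg M₁ M₂ e₁ e₂ o₁ o₂ none (unionInit M₁ M₂ Γ) [] [] [b] (fun _ => []) (fun _ => []) := by
  refine (haltList_eq _ _).trans (congrArg (TM2.Cfg.mk _ _) (funext fun k => ?_))
  cases k <;> rfl

/-- Deterministic computability asks for a clean final configuration. The two pops that test for a
single output letter also empty the output stacks of the components, and the last step resets the
state. -/
theorem finalCfg_haltList (a : M₁.Γ M₁.k₁) (b : M₂.Γ M₂.k₁) :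
    finalCfg M₁ M₂ e₁ e₂ o₁ o₂ (haltList M₁.toFinTM2 [a]).stk (haltList M₂.toFinTM2 [b]).stk =
      haltList (unionNTM M₁ M₂ e₁ e₂ o₁ o₂).toFinTM2 [(o₁ a || o₂ b : Bool)] := by
  refine Eq.trans ?_ (haltList_unionNTM _).symm
  rw [haltList_eq, haltList_eq]
  simp [finalCfg, isAccepting]

/-! ### Running time and results of the union machine. -/

open NTM

/-- Each letter costs one step, and noticing the empty stack one more. Loading reverses the word,
which undoes the reversal caused by unloading. -/
theorem bounded_loadCfg {T : ℕ} {b : Option Γ} {t w : List Γ}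
    (h : (unionNTM M₁ M₂ e₁ e₂ o₁ o₂).Bounded T
      (fstCfg M₁ M₂ e₁ e₂ o₁ o₂ (initList M₂.toFinTM2 ((t.reverse ++ w).map e₂)).stk
        (initList M₁.toFinTM2 ((t.reverse ++ w).map e₁)))) :
    (unionNTM M₁ M₂ e₁ e₂ o₁ o₂).Bounded (T + 1 + t.length)
      (loadCfg M₁ M₂ e₁ e₂ o₁ o₂ b t w) := by
  induction t generalizing b w with
  | nil =>
    refine bounded_of_step_iff (step_loadCfg_nil b w) ?_
    rw [initList_eq, initList_eq] at h
    exact h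
  | cons a t ih =>
    refine bounded_of_step_iff (step_loadCfg_cons b a t w) (ih ?_)
    simpa using h

theorem haltsAt_loadCfg {b : Option Γ} {t w : List Γ} (d) :
    (unionNTM M₁ M₂ e₁ e₂ o₁ o₂).HaltsAt (loadCfg M₁ M₂ e₁ e₂ o₁ o₂ b t w) d ↔
      (unionNTM M₁ M₂ e₁ e₂ o₁ o₂).HaltsAt
        (fstCfg M₁ M₂ e₁ e₂ o₁ o₂ (initList M₂.toFinTM2 ((t.reverse ++ w).map e₂)).stk
          (initList M₁.toFinTM2 ((t.reverse ++ w).map e₁))) d := by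
  induction t generalizing b w with
  | nil =>
    rw [haltsAt_of_step_iff (step_loadCfg_nil b w), initList_eq, initList_eq]
    rfl
  | cons a t ih =>
    rw [haltsAt_of_step_iff (step_loadCfg_cons b a t w), ih]
    simp

theorem bounded_unloadCfg {T : ℕ} {b : Option Γ} {i t : List Γ}
    (h : (unionNTM M₁ M₂ e₁ e₂ o₁ o₂).Bounded T
      (loadCfg M₁ M₂ e₁ e₂ o₁ o₂ none (i.reverse ++ t) [])) :
    (unionNTM M₁ M₂ e₁ e₂ o₁ o₂).Bounded (T + 1 + i.length)
      (unloadCfg M₁ M₂ e₁ e₂ o₁ o₂ b i t) := by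
  induction i generalizing b t with
  | nil => exact bounded_of_step_iff (step_unloadCfg_nil b t) h
  | cons a i ih =>
    refine bounded_of_step_iff (step_unloadCfg_cons b a i t) (ih ?_)
    simpa using h

theorem haltsAt_unloadCfg {b : Option Γ} {i t : List Γ} (d) :
    (unionNTM M₁ M₂ e₁ e₂ o₁ o₂).HaltsAt (unloadCfg M₁ M₂ e₁ e₂ o₁ o₂ b i t) d ↔
      (unionNTM M₁ M₂ e₁ e₂ o₁ o₂).HaltsAt
        (loadCfg M₁ M₂ e₁ e₂ o₁ o₂ none (i.reverse ++ t) []) d := by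
  induction i generalizing b t with
  | nil => rw [haltsAt_of_step_iff (step_unloadCfg_nil b t)]; rfl
  | cons a i ih =>
    rw [haltsAt_of_step_iff (step_unloadCfg_cons b a i t), ih]
    simp

/-- The exit label of the first run is the main label of the second machine, whose input is already
waiting, so no step is spent in between. -/
theorem fstCfg_of_halted {w : List (M₂.Γ M₂.k₀)} {c : M₁.Cfg} (hc : c.l = none) :
    fstCfg M₁ M₂ e₁ e₂ o₁ o₂ (initList M₂.toFinTM2 w).stk c =
      sndCfg M₁ M₂ e₁ e₂ o₁ o₂ c.var c.stk (initList M₂.toFinTM2 w) := by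
  rw [fstCfg, hc]
  rfl

theorem step_sndCfg_of_halted {v₁ : M₁.σ} {S₁ : ∀ k, List (M₁.Γ k)} {c : M₂.Cfg}
    (hc : c.l = none) (d) :
    (unionNTM M₁ M₂ e₁ e₂ o₁ o₂).Step (sndCfg M₁ M₂ e₁ e₂ o₁ o₂ v₁ S₁ c) d ↔
      d = finalCfg M₁ M₂ e₁ e₂ o₁ o₂ S₁ c.stk := by
  rw [sndCfg, hc]
  exact step_finish _ _ _ _

theorem bounded_unionNTM {w : List Γ} {T₁ T₂ : ℕ}
    (h₁ : M₁.Bounded T₁ (initList M₁.toFinTM2 (w.map e₁)))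
    (h₂ : M₂.Bounded T₂ (initList M₂.toFinTM2 (w.map e₂))) :
    (unionNTM M₁ M₂ e₁ e₂ o₁ o₂).Bounded (T₁ + (T₂ + (0 + 1)) + 1 + w.length + 1 + w.length)
      (initList (unionNTM M₁ M₂ e₁ e₂ o₁ o₂).toFinTM2 w) := by
  rw [initList_unionNTM]
  refine bounded_unloadCfg ?_
  rw [List.append_nil, ← List.length_reverse (as := w)]
  refine bounded_loadCfg ?_
  rw [List.reverse_reverse, List.append_nil]
  refine bounded_of_simulation _ (step_fstCfg _) h₁ fun d hd => ?_
  rw [fstCfg_of_halted hd.2]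
  refine bounded_of_simulation _ (step_sndCfg _ _) h₂ fun e he => ?_
  exact bounded_of_step_iff (step_sndCfg_of_halted he.2) (bounded_of_halted rfl)

theorem haltsAt_unionNTM {w : List Γ} {T₁ T₂ : ℕ}
    (h₁ : M₁.Bounded T₁ (initList M₁.toFinTM2 (w.map e₁)))
    (h₂ : M₂.Bounded T₂ (initList M₂.toFinTM2 (w.map e₂))) (d) :
    (unionNTM M₁ M₂ e₁ e₂ o₁ o₂).HaltsAt
        (initList (unionNTM M₁ M₂ e₁ e₂ o₁ o₂).toFinTM2 w) d ↔
      ∃ c₁, M₁.HaltsAt (initList M₁.toFinTM2 (w.map e₁)) c₁ ∧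
        ∃ c₂, M₂.HaltsAt (initList M₂.toFinTM2 (w.map e₂)) c₂ ∧
          d = finalCfg M₁ M₂ e₁ e₂ o₁ o₂ c₁.stk c₂.stk := by
  rw [initList_unionNTM, haltsAt_unloadCfg, haltsAt_loadCfg, List.append_nil,
    List.append_nil, List.reverse_reverse,
    haltsAt_of_simulation _ (fun c => Option.some_ne_none _) (step_fstCfg _) h₁]
  refine exists_congr fun c₁ => and_congr_right fun hc₁ => ?_
  rw [fstCfg_of_halted hc₁.2,
    haltsAt_of_simulation _ (fun c => Option.some_ne_none _) (step_sndCfg _ _) h₂]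
  refine exists_congr fun c₂ => and_congr_right fun hc₂ => ?_
  rw [haltsAt_of_step_iff (step_sndCfg_of_halted hc₂.2), haltsAt_of_halted rfl]

end Machine

/-! ### Closure of NP and P under unions of letterwise preimages. -/

section Classes

open NTM

variable {Γ Γ₁ Γ₂ : Type} [Finite Γ] [Nonempty Γ] {L₁ : Language Γ₁} {L₂ : Language Γ₂}
  {L : Language Γ} (g₁ : Γ → Γ₁) (g₂ : Γ → Γ₂)

/-- Every configuration from which all paths are finite leads to a halting configuration. -/
theorem NTM.Bounded.exists_haltsAt {M : NTM} {T : ℕ} {c : M.Cfg} (h : M.Bounded T c) :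
    ∃ d, M.HaltsAt c d := by
  induction T generalizing c with
  | zero => exact ⟨c, (haltsAt_of_halted h.halted).2 rfl⟩
  | succ T ih =>
    by_cases hc : c.l = none
    · exact ⟨c, (haltsAt_of_halted hc).2 rfl⟩
    · obtain ⟨e, he⟩ := exists_step hc
      obtain ⟨d, hd⟩ := ih (h.of_step he)
      exact ⟨d, (haltsAt_iff_step hc).2 ⟨e, he, hd⟩⟩

theorem InNP.union_comap (hL : ∀ w, w ∈ L ↔ w.map g₁ ∈ L₁ ∨ w.map g₂ ∈ L₂)
    (h₁ : InNP L₁) (h₂ : InNP L₂) : InNP L := by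
  obtain ⟨M₁, inp₁, out₁, p₁, h₁⟩ := h₁
  obtain ⟨M₂, inp₂, out₂, p₂, h₂⟩ := h₂
  have := Fintype.ofFinite Γ
  -- The default letter only makes `getD` total: letters are pushed after a test that the buffer is
  -- full.
  have := Classical.inhabited_of_nonempty ‹Nonempty Γ›
  let e₁ : Γ → M₁.Γ M₁.k₀ := inp₁.symm ∘ g₁
  let e₂ : Γ → M₂.Γ M₂.k₀ := inp₂.symm ∘ g₂
  have hb₁ (w : List Γ) : M₁.Bounded (p₁.eval w.length) (initList M₁.toFinTM2 (w.map e₁)) := by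
    have := (h₁ (w.map g₁)).1
    rwa [List.map_map, List.length_map] at this
  have hb₂ (w : List Γ) : M₂.Bounded (p₂.eval w.length) (initList M₂.toFinTM2 (w.map e₂)) := by
    have := (h₂ (w.map g₂)).1
    rwa [List.map_map, List.length_map] at this
  have ha₁ (w : List Γ) : w.map g₁ ∈ L₁ ↔ ∃ c, M₁.HaltsAt (initList M₁.toFinTM2 (w.map e₁)) c ∧
      isAccepting out₁ (c.stk M₁.k₁) = true := by
    rw [(h₁ (w.map g₁)).2, List.map_map, exists_comm]
    simp only [isAccepting_iff, HaltsAt, exists_and_right, and_assoc]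
    rfl
  have ha₂ (w : List Γ) : w.map g₂ ∈ L₂ ↔ ∃ c, M₂.HaltsAt (initList M₂.toFinTM2 (w.map e₂)) c ∧
      isAccepting out₂ (c.stk M₂.k₁) = true := by
    rw [(h₂ (w.map g₂)).2, List.map_map, exists_comm]
    simp only [isAccepting_iff, HaltsAt, exists_and_right, and_assoc]
    rfl
  -- The polynomial adds both running times, one step for the evaluation, and two passes over the
  -- input of `|w| + 1` steps each.
  refine ⟨unionNTM M₁ M₂ e₁ e₂ out₁ out₂, Equiv.refl Γ, Equiv.refl Bool,
    p₁ + (p₂ + (0 + 1)) + 1 + .X + 1 + .X, fun w => ?_⟩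
  -- The input of the machine is `w` mapped by the identity, which equals `w` only propositionally.
  suffices h : ∀ w' : List Γ, w' = w →
      (∀ k c, (unionNTM M₁ M₂ e₁ e₂ out₁ out₂).Run k (initList _ w') c → k ≤ _) ∧
      (w ∈ L ↔ ∃ k c, (unionNTM M₁ M₂ e₁ e₂ out₁ out₂).Run k (initList _ w') c ∧
        c.l = none ∧ c.stk .output = [true]) from h _ (List.map_id w)
  rintro w rfl
  constructor
  · intro k c hk
    have := bounded_unionNTM (o₁ := out₁) (o₂ := out₂) (hb₁ w) (hb₂ w) k c hk
    simpa only [Polynomial.eval_add, Polynomial.eval_X, Polynomial.eval_one, Polynomial.eval_zero]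
      using this
  · have key := haltsAt_unionNTM (o₁ := out₁) (o₂ := out₂) (hb₁ w) (hb₂ w)
    -- An accepting path of one component extends to a path of the union machine only because the
    -- other component has some halting path, whatever its answer.
    obtain ⟨d₁, hd₁⟩ := (hb₁ w).exists_haltsAt
    obtain ⟨d₂, hd₂⟩ := (hb₂ w).exists_haltsAt
    rw [hL, ha₁, ha₂]
    constructor
    · rintro (⟨c, hc, ha⟩ | ⟨c, hc, ha⟩)
      · obtain ⟨⟨k, hk⟩, hn⟩ := (key _).2 ⟨c, hc, d₂, hd₂, rfl⟩
        refine ⟨k, _, hk, hn, congrArg (fun b => [b]) ?_⟩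
        exact Bool.or_eq_true_iff.2 (.inl ha)
      · obtain ⟨⟨k, hk⟩, hn⟩ := (key _).2 ⟨d₁, hd₁, c, hc, rfl⟩
        refine ⟨k, _, hk, hn, congrArg (fun b => [b]) ?_⟩
        exact Bool.or_eq_true_iff.2 (.inr ha)
    · rintro ⟨k, d, hk, hn, ha⟩
      obtain ⟨c₁, hc₁, c₂, hc₂, rfl⟩ := (key d).1 ⟨⟨k, hk⟩, hn⟩
      exact (Bool.or_eq_true_iff.1 (List.singleton_injective ha)).imp
        (⟨c₁, hc₁, ·⟩) (⟨c₂, hc₂, ·⟩)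

/-- A machine that computes a Boolean function in polynomial time has exactly one halting
configuration, which is reached within the time bound. -/
theorem computes_ofDet {f : List Γ₁ → Bool}
    (h : TM2ComputableInPolyTime (fun w : List Γ₁ => w) Computability.encodeBool f)
    (w : List Γ₁) :
    (ofDet h.tm).Bounded (h.time.eval w.length)
        (initList h.tm (w.map h.inputAlphabet.symm)) ∧
      ∀ c, (ofDet h.tm).HaltsAt (initList h.tm (w.map h.inputAlphabet.symm)) c ↔
        c = haltList h.tm ((Computability.encodeBool (f w)).map h.outputAlphabet.symm) := by
  have hr := (run_ofDet h.tm _ _ _).2 (h.outputsFun w).evals_in_steps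
  have hu := run_unique h.tm hr rfl
  exact ⟨fun k d hd => (hu.1 k d hd).trans (h.outputsFun w).steps_le_m, hu.2⟩

theorem InP.union_comap (hL : ∀ w, w ∈ L ↔ w.map g₁ ∈ L₁ ∨ w.map g₂ ∈ L₂)
    (h₁ : InP L₁) (h₂ : InP L₂) : InP L := by
  obtain ⟨f₁, hf₁, ⟨h₁⟩⟩ := h₁
  obtain ⟨f₂, hf₂, ⟨h₂⟩⟩ := h₂
  have := Fintype.ofFinite Γ
  have := Classical.inhabited_of_nonempty ‹Nonempty Γ›
  let M₁ := ofDet h₁.tm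
  let M₂ := ofDet h₂.tm
  let e₁ : Γ → M₁.Γ M₁.k₀ := h₁.inputAlphabet.symm ∘ g₁
  let e₂ : Γ → M₂.Γ M₂.k₀ := h₂.inputAlphabet.symm ∘ g₂
  let M := unionNTM M₁ M₂ e₁ e₂ h₁.outputAlphabet h₂.outputAlphabet
  refine ⟨fun w => f₁ (w.map g₁) || f₂ (w.map g₂), fun w => ?_,
    ⟨⟨M.toFinTM2, Equiv.refl Γ, Equiv.refl Bool⟩,
      h₁.time + (h₂.time + (0 + 1)) + 1 + .X + 1 + .X, fun w => Classical.choice ?_⟩⟩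
  · rw [hL, Bool.or_eq_true_iff, hf₁, hf₂]
  · have hc₁ := computes_ofDet h₁ (w.map g₁)
    have hc₂ := computes_ofDet h₂ (w.map g₂)
    rw [List.map_map, List.length_map] at hc₁ hc₂
    have hb := bounded_unionNTM (M₁ := M₁) (M₂ := M₂) (e₁ := e₁) (e₂ := e₂)
      (o₁ := h₁.outputAlphabet) (o₂ := h₂.outputAlphabet) hc₁.1 hc₂.1
    obtain ⟨⟨k, hk⟩, -⟩ := (haltsAt_unionNTM (M₁ := M₁) (M₂ := M₂) (e₁ := e₁) (e₂ := e₂)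
      (o₁ := h₁.outputAlphabet) (o₂ := h₂.outputAlphabet) hc₁.1 hc₂.1 _).2
      ⟨_, (hc₁.2 _).2 rfl, _, (hc₂.2 _).2 rfl, rfl⟩
    have hfinal := finalCfg_haltList (M₁ := M₁) (M₂ := M₂) (e₁ := e₁) (e₂ := e₂)
      (o₁ := h₁.outputAlphabet) (o₂ := h₂.outputAlphabet)
      (h₁.outputAlphabet.symm (f₁ (w.map g₁))) (h₂.outputAlphabet.symm (f₂ (w.map g₂)))
    have hout : (h₁.outputAlphabet (h₁.outputAlphabet.symm (f₁ (w.map g₁))) ||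
        h₂.outputAlphabet (h₂.outputAlphabet.symm (f₂ (w.map g₂)))) =
        (f₁ (w.map g₁) || f₂ (w.map g₂)) := by
      simp only [Equiv.apply_symm_apply]
    have hfinal' := hfinal.trans (congrArg (fun b : Bool => haltList M.toFinTM2 [b]) hout)
    suffices h : ∀ w' : List Γ, w' = w →
        Nonempty (TM2OutputsInTime M.toFinTM2 w' (some [(f₁ (w.map g₁) || f₂ (w.map g₂) : Bool)])
          ((h₁.time + (h₂.time + (0 + 1)) + 1 + .X + 1 + .X).eval w.length)) from
      h _ (List.map_id w)
    rintro w rfl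
    refine ⟨⟨⟨k, ?_⟩, ?_⟩⟩
    -- Both components have two equal programs, hence so does `M`, and `M` is by definition the
    -- nondeterministic version of `M.toFinTM2`.
    · exact ((run_ofDet M.toFinTM2 _ _ _).1 hk).trans (congrArg some hfinal')
    · simpa only [Polynomial.eval_add, Polynomial.eval_X, Polynomial.eval_one,
        Polynomial.eval_zero] using hb k _ hk

end Classes

end RelAlg

theorem mainTheorem10 {A₁ A₂ : Type} [RelAlg.RelationAlgebra A₁] [RelAlg.RelationAlgebra A₂]
    [Finite A₁] [Finite A₂]
    (h₁ : RelAlg.Representable A₁) (h₂ : RelAlg.Representable A₂) :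
    (RelAlg.InP (RelAlg.NSP A₁) → RelAlg.InP (RelAlg.NSP A₂) →
      RelAlg.InP (RelAlg.NSP (A₁ × A₂))) ∧
    (RelAlg.InNP (RelAlg.NSP A₁) → RelAlg.InNP (RelAlg.NSP A₂) →
      RelAlg.InNP (RelAlg.NSP (A₁ × A₂))) :=
  ⟨RelAlg.InP.union_comap Prod.fst Prod.snd RelAlg.mem_NSP_prod_iff,
    RelAlg.InNP.union_comap Prod.fst Prod.snd RelAlg.mem_NSP_prod_iff⟩
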